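/- Let $\diamondsuit^+$ denote the following principle: there are countable families $\mathcal S_\beta=\{S_{\beta,n}:n\in\omega\}$, for $\beta<\omega_1$, such that for every $X\subseteq\omega_1$ there is a closed unbounded $C\subseteq\omega_1$ such that for every $\beta\in C$ there is $n\in\omega$ with $X\cap\beta=S_{\beta,n}$. (Often one requires in addition that $C\cap\beta\in\mathcal S_\beta$; the theorem below then holds a fortiori.) For an undirected graph $G$, the chromatic number $\chi(G)$ is the minimal (possibly infinite) cardinality of a family of independent sets covering the vertices of $G$; for a digraph $D$, the dichromatic number $\chi(D)$ is the minimal cardinality of a family of acyclic vertex sets (sets $A$ such that the induced digraph $D[A]$ contains no directed cycle) covering the vertices of $D$. An orientation of $G$ is a digraph $D$ on the vertex set of $G$ which has an arc between $u$ and $v$, in exactly one of the two directions, if and only if $uv$ is an edge of $G$. The orientation-dichromatic number of $G$ is $\sup\{\chi(D): D\text{ is an orientation of }G\}$. The half graph $H_{\omega,\omega}$ has vertex set $\omega\times 2$, and its edges are the pairs $\{(k,0),(\ell,1)\}$ with $k\le\ell<\omega$. A digraph embeds into another if it is isomorphic to a not necessarily induced subgraph of it. **Theorem.** Assume $\diamondsuit^+$,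 and let $G$ be a graph with $|V(G)|=\omega_1$. 1. If $\chi(G)=\omega_1$, then there is an orientation $D^*$ of $G$ such that, whenever $A\subseteq V(G)$ and the induced subgraph $G[A]$ has uncountable chromatic number, every orientation of $H_{\omega,\omega}$ embeds into $D^*[A]$. 2. $\chi(G)=\omega_1$ if and only if the orientation-dichromatic number of $G$ is $\omega_1$. -/

import Mathlib

open Cardinal Ordinal

/-- The first uncountable ordinal, as a well-ordered type. -/
abbrev OmegaOne : Type := (ω_ 1 : Ordinal.{0}).ToType

/-- The guessing principle `◇⁺` in the form: there are countable families
`𝒮_β = {S β n : n < ω}`, for `β < ω₁`, such that for every `X ⊆ ω₁` there is a club `C ⊆ ω₁` with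
`X ∩ β ∈ 𝒮_β` for all `β ∈ C`. (Many texts demand moreover that `C ∩ β ∈ 𝒮_β`; that formally
stronger principle implies this one.) -/
def DiamondPlus : Prop :=
  ∃ S : OmegaOne → ℕ → Set OmegaOne, ∀ X : Set OmegaOne,
    ∃ C : Set OmegaOne, IsClub C ∧ ∀ β ∈ C, ∃ n : ℕ, X ∩ Set.Iio β = S β n

/-- The chromatic number of a graph, as a cardinal: the minimal number of independent sets needed
to cover the vertex set. -/
noncomputable def SimpleGraph.cardChromaticNumber {V : Type*} (G : SimpleGraph V) : Cardinal :=
  sInf {κ | ∃ 𝒜 : Set (Set V), (∀ A ∈ 𝒜, G.IsIndepSet A) ∧ ⋃₀ 𝒜 = Set.univ ∧ #𝒜 = κ}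

/-- The digraph induced by `D` on a set `A` of vertices. -/
def Digraph.inducedOn {V : Type*} (D : Digraph V) (A : Set V) : Digraph A where
  Adj u v := D.Adj u v

/-- `D₀` embeds into `D` as a (not necessarily induced) subgraph. -/
def Digraph.EmbedsInto {U V : Type*} (D₀ : Digraph U) (D : Digraph V) : Prop :=
  ∃ f : U → V, Function.Injective f ∧ ∀ u v, D₀.Adj u v → D.Adj (f u) (f v)

/-- `D` is an orientation of `G`: between two vertices there is an arc of `D`, in exactly one of
the two directions, if and only if they are joined by an edge of `G`. -/
structure Digraph.IsOrientationOf {V : Type*} (D : Digraph V) (G : SimpleGraph V) : Prop where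
  adj_iff : ∀ u v, G.Adj u v ↔ D.Adj u v ∨ D.Adj v u
  asymm : ∀ u v, D.Adj u v → ¬ D.Adj v u

/-- The directed cycle with `n` vertices (for `n ≥ 1`). -/
def Digraph.directedCycle (n : ℕ) : Digraph (ZMod n) where
  Adj i j := j = i + 1

/-- A set `A` of vertices is acyclic in `D` if `D[A]` contains no directed cycle. (An orientation
of a simple graph has no directed cycle with fewer than three vertices.) -/
def Digraph.IsAcyclicSet {V : Type*} (D : Digraph V) (A : Set V) : Prop :=
  ∀ n : ℕ, 1 ≤ n → ¬ (Digraph.directedCycle n).EmbedsInto (D.inducedOn A)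

/-- The dichromatic number of a digraph: the minimal number of acyclic sets needed to cover the
vertex set. -/
noncomputable def Digraph.dichromaticNumber {V : Type*} (D : Digraph V) : Cardinal :=
  sInf {κ | ∃ 𝒜 : Set (Set V), (∀ A ∈ 𝒜, D.IsAcyclicSet A) ∧ ⋃₀ 𝒜 = Set.univ ∧ #𝒜 = κ}

/-- The orientation-dichromatic number of a graph: the supremum of the dichromatic numbers of its
orientations. -/
noncomputable def SimpleGraph.orientationDichromaticNumber {V : Type*} (G : SimpleGraph V) :
    Cardinal :=
  ⨆ D : {D : Digraph V // D.IsOrientationOf G}, D.1.dichromaticNumber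

/-- The half graph `H_{ω,ω}` on `ω × 2`: the edges join `(k, 0)` and `(l, 1)` for `k ≤ l`. -/
def halfGraph : SimpleGraph (ℕ × Fin 2) where
  Adj p q := (p.2 = 0 ∧ q.2 = 1 ∧ p.1 ≤ q.1) ∨ (q.2 = 0 ∧ p.2 = 1 ∧ q.1 ≤ p.1)
  symm := ⟨fun _ _ h => Or.symm h⟩
  loopless := ⟨fun p h => by rcases h with ⟨h0, h1, -⟩ | ⟨h0, h1, -⟩ <;> simp [h0] at h1⟩

namespace OmegaOne

theorem mk_eq : #OmegaOne = ℵ₁ := by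
  simp [OmegaOne]

theorem not_countable : ¬ (Set.univ : Set OmegaOne).Countable := by
  rw [← Cardinal.le_aleph0_iff_set_countable, Cardinal.mk_univ, mk_eq, not_le]
  exact Cardinal.aleph0_lt_aleph_one

theorem countable_Iio (a : OmegaOne) : (Set.Iio a).Countable := by
  have h := Cardinal.mk_Iio_lt a (by simp)
  rwa [mk_eq, ← Cardinal.succ_aleph0, Order.lt_succ_iff,
    Cardinal.le_aleph0_iff_set_countable] at h

theorem countable_Iic (a : OmegaOne) : (Set.Iic a).Countable := by
  rw [← Set.Iio_insert]
  exact (countable_Iio a).insert a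

theorem exists_forall_lt {s : Set OmegaOne} (hs : s.Countable) : ∃ y, ∀ x ∈ s, x < y := by
  by_contra! h
  refine not_countable ((hs.biUnion fun x _ => countable_Iic x).mono fun y _ => ?_)
  obtain ⟨x, hx, hy⟩ := h y
  exact Set.mem_biUnion hx hy

theorem cof_ne_aleph0 : Order.cof OmegaOne ≠ ℵ₀ := by
  have h : Order.cof OmegaOne = ℵ₁ := by simp [OmegaOne]
  rw [h]
  exact Cardinal.aleph0_lt_aleph_one.ne'

theorem exists_isLUB {s : Set OmegaOne} (hs : BddAbove s) : ∃ x, IsLUB s x := by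
  obtain ⟨x, hx, hmin⟩ := wellFounded_lt.has_min (upperBounds s) hs
  exact ⟨x, hx, fun y hy => not_lt.1 (hmin y hy)⟩

theorem isClub_closed_under (h : OmegaOne → OmegaOne) :
    IsClub {d : OmegaOne | ∀ x < d, h x < d} := by
  refine ⟨fun t ht _ _ x hx y hy => ?_, fun a => ?_⟩
  · obtain ⟨z, hz, hyz⟩ := (lt_isLUB_iff hx).1 hy
    exact (ht hz y hyz).trans_le (hx.1 hz)
  · have hstep : ∀ x, ∃ y, ∀ z ∈ h '' Set.Iic x, z < y := fun x =>
      exists_forall_lt ((countable_Iic x).image h)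
    choose g hg using hstep
    let s : ℕ → OmegaOne := fun n => Nat.rec a (fun _ x => g x) n
    obtain ⟨y, hy⟩ := exists_forall_lt (Set.countable_range s)
    obtain ⟨d, hd⟩ := exists_isLUB (s := Set.range s) ⟨y, fun z hz => (hy z hz).le⟩
    refine ⟨d, fun x hx => ?_, hd.1 ⟨0, rfl⟩⟩
    obtain ⟨_, ⟨n, rfl⟩, hxn⟩ := (lt_isLUB_iff hd).1 hx
    exact (hg (s n) (h x) ⟨x, hxn.le, rfl⟩).trans_le (hd.1 ⟨n + 1, rfl⟩)

end OmegaOne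

/-- If every element of a well-order has only finitely many designated predecessors, then there is
a colouring with natural numbers which separates each element from these predecessors. -/
theorem exists_nat_coloring_of_finite_predecessors {α : Type*} [LinearOrder α] [WellFoundedLT α]
    (F : α → Set α) (hF : ∀ b, (F b).Finite) :
    ∃ g : α → ℕ, ∀ b, ∀ a ∈ F b, a < b → g b ≠ g a := by
  classical
  let step : (b : α) → ((a : α) → a < b → ℕ) → ℕ := fun b ih =>
    sInf {n | ∀ a, ∀ h : a < b, a ∈ F b → n ≠ ih a h}
  let g : α → ℕ := wellFounded_lt.fix step
  refine ⟨g, fun b a ha hab => ?_⟩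
  have hg : g b = sInf {n | ∀ a, a < b → a ∈ F b → n ≠ g a} := wellFounded_lt.fix_eq step b
  have hne : {n | ∀ a, a < b → a ∈ F b → n ≠ g a}.Nonempty := by
    obtain ⟨n, hn⟩ := ((hF b).image g).exists_notMem
    exact ⟨n, fun a _ ha h => hn ⟨a, ha, h.symm⟩⟩
  have := Nat.sInf_mem hne
  rw [← hg] at this
  exact this a hab ha

/-- If, along a club, the vertices of `A` have only finitely many neighbours below the points of the
club, then the graph induced on `A` is countably colourable. -/
theorem exists_nat_coloring_of_isClub (G : SimpleGraph OmegaOne) (A C : Set OmegaOne)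
    (hC : IsClub C)
    (hfin : ∀ d ∈ C, ∀ b ∈ A, d ≤ b → {a | a ∈ A ∧ a < d ∧ G.Adj b a}.Finite) :
    ∃ f : OmegaOne → ℕ, ∀ x ∈ A, ∀ y ∈ A, G.Adj x y → f x ≠ f y := by
  have hnext : ∀ b, ∃ d ∈ C, b < d ∧ ∀ d' ∈ C, b < d' → d ≤ d' := by
    intro b
    have hne : {d | d ∈ C ∧ b < d}.Nonempty := by
      obtain ⟨y, hy⟩ := OmegaOne.exists_forall_lt (Set.countable_singleton b)
      obtain ⟨d, hd, hyd⟩ := hC.isCofinal y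
      exact ⟨d, hd, (hy b rfl).trans_le hyd⟩
    obtain ⟨d, hd, hmin⟩ := wellFounded_lt.has_min _ hne
    exact ⟨d, hd.1, hd.2, fun d' h1 h2 => not_lt.1 (hmin d' ⟨h1, h2⟩)⟩
  choose m hmC hlt hmin using hnext
  have henum : ∀ d : OmegaOne, ∃ e : OmegaOne → ℕ, Set.InjOn e (Set.Iio d) := fun d =>
    Set.countable_iff_exists_injOn.1 (OmegaOne.countable_Iio d)
  choose e he using henum
  have hF : ∀ b, {a | a ∈ A ∧ b ∈ A ∧ m a ≤ b ∧ G.Adj b a}.Finite := by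
    intro b
    by_cases hb : b ∈ A
    · by_cases ht : {d | d ∈ C ∧ d ≤ b}.Nonempty
      · obtain ⟨d, hd⟩ := OmegaOne.exists_isLUB (s := {d | d ∈ C ∧ d ≤ b}) ⟨b, fun _ h => h.2⟩
        have hdC : d ∈ C := hC.isLUB_mem (fun _ h => h.1) ht hd
        refine (hfin d hdC b hb (hd.2 fun _ h => h.2)).subset ?_
        rintro a ⟨ha, -, hmb, hadj⟩
        exact ⟨ha, (hlt a).trans_le (hd.1 ⟨hmC a, hmb⟩), hadj⟩
      · refine Set.finite_empty.subset ?_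
        rintro a ⟨-, -, hmb, -⟩
        exact ht ⟨m a, hmC a, hmb⟩
    · exact Set.finite_empty.subset fun a ha => hb ha.2.1
  obtain ⟨g, hg⟩ := exists_nat_coloring_of_finite_predecessors _ hF
  refine ⟨fun b => Nat.pair (e (m b) b) (g b), ?_⟩
  have key : ∀ x ∈ A, ∀ y ∈ A, x < y → G.Adj y x →
      Nat.pair (e (m y) y) (g y) ≠ Nat.pair (e (m x) x) (g x) := by
    intro x hx y hy hxy hadj heq
    obtain ⟨h1, h2⟩ := Nat.pair_eq_pair.1 heq
    by_cases hm : m x ≤ y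
    · exact hg y x ⟨hx, hy, hm, hadj⟩ hxy h2
    · have hmm : m y = m x :=
        le_antisymm (hmin y _ (hmC x) (not_le.1 hm)) (hmin x _ (hmC y) (hxy.trans (hlt y)))
      rw [hmm] at h1
      exact hxy.ne' (he (m x) (not_le.1 hm) (hlt x) h1)
  intro x hx y hy hadj
  rcases lt_or_gt_of_ne hadj.ne with h | h
  · exact (key x hx y hy h hadj.symm).symm
  · exact key y hy x hx h hadj

/-- A pair `p` of finite sets codes the condition on a set `c` that `c` and `p.2` agree on `p.1`.
For countably many families of such conditions there is a set `c` which meets every family that has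
members whose domains avoid any given finite set. -/
theorem exists_generic_set {α ι : Type*} [Countable ι] [Nonempty ι]
    (P : ι → Set (Finset α × Finset α)) :
    ∃ c : Set α, ∀ i, (∃ p ∈ P i, ∀ a ∈ p.1, (a ∈ c ↔ a ∈ p.2)) ∨
      ∃ K : Finset α, ∀ p ∈ P i, ¬ Disjoint p.1 K := by
  classical
  obtain ⟨s, hs⟩ := exists_surjective_nat ι
  have hf : ∀ n (K : Finset α), ∃ q : Finset α × Finset α,
      (∃ p ∈ P (s n), Disjoint p.1 K) → q ∈ P (s n) ∧ Disjoint q.1 K := by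
    intro n K
    by_cases h : ∃ p ∈ P (s n), Disjoint p.1 K
    · obtain ⟨p, hp⟩ := h
      exact ⟨p, fun _ => hp⟩
    · exact ⟨(∅, ∅), fun h' => absurd h' h⟩
  choose f hf using hf
  let K : ℕ → Finset α := fun n => Nat.rec ∅ (fun n K => K ∪ (f n K).1) n
  let p : ℕ → Finset α × Finset α := fun n => f n (K n)
  have hKsucc : ∀ n, K (n + 1) = K n ∪ (p n).1 := fun n => rfl
  have hKmono : Monotone K := monotone_nat_of_le_succ fun n => by
    rw [hKsucc]; exact Finset.subset_union_left
  let good : ℕ → Prop := fun n => ∃ q ∈ P (s n), Disjoint q.1 (K n)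
  have hdisj : ∀ n m, good m → n < m → ∀ a ∈ (p n).1, a ∉ (p m).1 := by
    intro n m hm hnm a ha ha'
    have h1 : a ∈ K m := hKmono (Nat.succ_le_of_lt hnm) (by
      rw [Nat.succ_eq_add_one, hKsucc]; exact Finset.mem_union_right _ ha)
    exact Finset.disjoint_left.1 (hf m (K m) hm).2 ha' h1
  refine ⟨{a | ∃ n, good n ∧ a ∈ (p n).1 ∧ a ∈ (p n).2}, fun i => ?_⟩
  obtain ⟨n, rfl⟩ := hs i
  rcases Classical.em (∃ q ∈ P (s n), Disjoint q.1 (K n)) with hn | hn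
  · refine Or.inl ⟨p n, (hf n (K n) hn).1, fun a ha => ⟨?_, fun h => ⟨n, hn, ha, h⟩⟩⟩
    rintro ⟨m, hm, ham, ham'⟩
    rcases lt_trichotomy n m with h | h | h
    · exact absurd ham (hdisj n m hm h a ha)
    · rwa [h]
    · exact absurd ha (hdisj m n hn h a ham)
  · exact Or.inr ⟨K n, fun q hq hd => hn ⟨q, hq, hd⟩⟩

/-- Under `◇⁺` one can choose sets `c b` so that every set `A` which is not countably colourable
contains a sequence of vertices on which every finite pattern is realised, by unboundedly many
common neighbours `b ∈ A`, as a trace of `c b`. -/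
theorem DiamondPlus.exists_pattern_family (hdiamond : DiamondPlus) (G : SimpleGraph OmegaOne) :
    ∃ c : OmegaOne → Set OmegaOne, ∀ A : Set OmegaOne,
      (¬ ∃ f : OmegaOne → ℕ, ∀ x ∈ A, ∀ y ∈ A, G.Adj x y → f x ≠ f y) →
      ∃ a : ℕ → OmegaOne, Function.Injective a ∧ (∀ n, a n ∈ A) ∧
        ∀ E T : Finset OmegaOne, E.Nonempty → (E : Set OmegaOne) ⊆ Set.range a → T ⊆ E →
          ∀ x, ∃ b ∈ A, x < b ∧ ∀ u ∈ E, u < b ∧ G.Adj b u ∧ (u ∈ c b ↔ u ∈ T) := by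
  classical
  obtain ⟨S, hS⟩ := hdiamond
  obtain ⟨e⟩ : Nonempty (Finset OmegaOne × Finset OmegaOne ↪ OmegaOne) := by
    have hinf : Infinite OmegaOne := by
      rw [Cardinal.infinite_iff, OmegaOne.mk_eq]; exact Cardinal.aleph0_lt_aleph_one.le
    refine Cardinal.le_def _ _ |>.1 ?_
    rw [Cardinal.mk_prod, Cardinal.mk_finset_of_infinite]
    simp
  have hc : ∀ b : OmegaOne, ∃ c : Set OmegaOne, ∀ i : Set.Iic b × ℕ,
      (∃ p ∈ {p : Finset OmegaOne × Finset OmegaOne |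
          e p ∈ S i.1 i.2 ∧ ∀ a ∈ p.1, a < b ∧ G.Adj b a}, ∀ a ∈ p.1, (a ∈ c ↔ a ∈ p.2)) ∨
      ∃ K : Finset OmegaOne, ∀ p ∈ {p : Finset OmegaOne × Finset OmegaOne |
          e p ∈ S i.1 i.2 ∧ ∀ a ∈ p.1, a < b ∧ G.Adj b a}, ¬ Disjoint p.1 K := by
    intro b
    have : Countable (Set.Iic b) := OmegaOne.countable_Iic b
    exact exists_generic_set _
  choose c hc using hc
  refine ⟨c, fun A hA => ?_⟩
  let R : Finset OmegaOne × Finset OmegaOne → OmegaOne → Prop := fun p b =>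
    ∀ u ∈ p.1, u < b ∧ G.Adj b u ∧ (u ∈ c b ↔ u ∈ p.2)
  let P : Set (Finset OmegaOne × Finset OmegaOne) :=
    {p | ∃ x, ∀ b ∈ A, R p b → b ≤ x}
  obtain ⟨C, hC, hguess⟩ := hS (e '' P)
  have hh : ∀ x, ∃ y, (∀ p : Finset OmegaOne × Finset OmegaOne,
      p.2 ⊆ p.1 → (∀ u ∈ p.1, u ≤ x) → e p ≤ y) ∧
      ∀ p ∈ P, e p = x → ∀ b ∈ A, R p b → b ≤ y := by
    intro x
    have hcount : {p : Finset OmegaOne × Finset OmegaOne |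
        p.2 ⊆ p.1 ∧ ∀ u ∈ p.1, u ≤ x}.Countable := by
      have hfin : {E : Finset OmegaOne | (E : Set OmegaOne) ⊆ Set.Iic x}.Countable :=
        ((Set.countable_ofPred_finite_subset (OmegaOne.countable_Iic x)).preimage_of_injOn
          Finset.coe_injective.injOn).mono fun E hE =>
            And.intro E.finite_toSet hE
      refine (hfin.prod hfin).mono ?_
      rintro p ⟨h1, h2⟩
      exact ⟨h2, fun u hu => h2 u (h1 hu)⟩
    obtain ⟨y, hy⟩ := OmegaOne.exists_forall_lt (hcount.image e)
    have hz : ∃ z, ∀ p ∈ P, e p = x → ∀ b ∈ A, R p b → b ≤ z := by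
      by_cases hp : ∃ p ∈ P, e p = x
      · obtain ⟨p, ⟨z, hz⟩, hpx⟩ := hp
        refine ⟨z, fun q _ hqx => ?_⟩
        obtain rfl : q = p := e.injective (hqx.trans hpx.symm)
        exact hz
      · exact ⟨x, fun p h1 h2 => absurd ⟨p, h1, h2⟩ hp⟩
    obtain ⟨z, hz⟩ := hz
    exact ⟨max y z, fun p h1 h2 => (hy _ ⟨p, ⟨h1, h2⟩, rfl⟩).le.trans (le_max_left _ _),
      fun p h1 h2 b h3 h4 => (hz p h1 h2 b h3 h4).trans (le_max_right _ _)⟩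
  choose h hcode hbound using hh
  obtain ⟨d, ⟨hdC, hdh⟩, b, hbA, hdb, hinf⟩ : ∃ d ∈ C ∩ {d | ∀ x < d, h x < d}, ∃ b ∈ A,
      d ≤ b ∧ {a | a ∈ A ∧ a < d ∧ G.Adj b a}.Infinite := by
    by_contra! hcon
    exact hA (exists_nat_coloring_of_isClub G A _
      (hC.inter OmegaOne.cof_ne_aleph0 (OmegaOne.isClub_closed_under h))
      fun d hd b hb hdb => by simpa using hcon d hd b hb hdb)
  obtain ⟨n, hn⟩ := hguess d hdC
  obtain ⟨p, ⟨hpS, hpN⟩, hpc⟩ | ⟨K, hK⟩ := hc b (⟨d, hdb⟩, n)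
  · rw [← hn] at hpS
    obtain ⟨⟨q, hqP, hqp⟩, hpd⟩ := hpS
    obtain rfl : q = p := e.injective hqp
    have hlt := (hbound _ q hqP rfl b hbA
      fun u hu => ⟨(hpN u hu).1, (hpN u hu).2, hpc u hu⟩).trans_lt (hdh _ hpd)
    exact absurd hlt hdb.not_gt
  · have hinf' := hinf.sdiff K.finite_toSet
    let a := hinf'.natEmbedding
    refine ⟨fun n => a n, Subtype.val_injective.comp a.injective, fun n => (a n).2.1.1, ?_⟩
    intro E T hE hEa hTE
    have hEmem : ∀ u ∈ E, u ∈ {a | a ∈ A ∧ a < d ∧ G.Adj b a} \ (K : Set OmegaOne) := by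
      intro u hu
      obtain ⟨n, rfl⟩ := hEa hu
      exact (a n).2
    have hnot : (E, T) ∉ P := by
      intro hP
      refine hK (E, T) ⟨?_, fun u hu => ⟨(hEmem u hu).1.2.1.trans_le hdb, (hEmem u hu).1.2.2⟩⟩
        (Finset.disjoint_left.2 fun u hu => (hEmem u hu).2)
      have hlt : e (E, T) < d :=
        (hcode (E.max' hE) (E, T) hTE fun u hu => E.le_max' u hu).trans_lt
          (hdh _ (hEmem _ (E.max'_mem hE)).1.2.1)
      have : e (E, T) ∈ e '' P ∩ Set.Iio d := ⟨⟨_, hP, rfl⟩, hlt⟩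
      rwa [hn] at this
    intro x
    by_contra! hcon
    refine hnot ⟨x, fun b' hb' hR => not_lt.1 fun hx => ?_⟩
    obtain ⟨u, hu, hu'⟩ := hcon b' hb' hx
    obtain ⟨h1, h2, h3⟩ := hR u hu
    rcases hu' h1 h2 with ⟨h4, h5⟩ | ⟨h4, h5⟩
    · exact h5 (h3.1 h4)
    · exact h4 (h3.2 h5)

theorem Digraph.EmbedsInto.trans {U V W : Type*} {D₁ : Digraph U} {D₂ : Digraph V}
    {D₃ : Digraph W} (h₁ : D₁.EmbedsInto D₂) (h₂ : D₂.EmbedsInto D₃) : D₁.EmbedsInto D₃ := by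
  obtain ⟨f, hf, hf'⟩ := h₁
  obtain ⟨g, hg, hg'⟩ := h₂
  exact ⟨g ∘ f, hg.comp hf, fun u v h => hg' _ _ (hf' u v h)⟩

/-- The orientation result for graphs on `ω₁`, with countable colourings in place of cardinals. -/
theorem DiamondPlus.exists_orientation_omegaOne (hdiamond : DiamondPlus)
    (G : SimpleGraph OmegaOne) :
    ∃ Dstar : Digraph OmegaOne, Dstar.IsOrientationOf G ∧ ∀ A : Set OmegaOne,
      (¬ ∃ f : OmegaOne → ℕ, ∀ x ∈ A, ∀ y ∈ A, G.Adj x y → f x ≠ f y) →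
      ∀ D : Digraph (ℕ × Fin 2), D.IsOrientationOf halfGraph →
        D.EmbedsInto (Dstar.inducedOn A) := by
  classical
  obtain ⟨c, hc⟩ := hdiamond.exists_pattern_family G
  refine ⟨⟨fun x y => G.Adj x y ∧ ((y < x ∧ y ∈ c x) ∨ (x < y ∧ x ∉ c y))⟩, ⟨?_, ?_⟩, ?_⟩
  · intro u v
    refine ⟨fun h => ?_, fun h => h.elim (·.1) (·.1.symm)⟩
    have h' := h.symm
    rcases lt_or_gt_of_ne h.ne with hlt | hlt
    · by_cases hm : u ∈ c v
      · exact Or.inr ⟨h', Or.inl ⟨hlt, hm⟩⟩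
      · exact Or.inl ⟨h, Or.inr ⟨hlt, hm⟩⟩
    · by_cases hm : v ∈ c u
      · exact Or.inl ⟨h, Or.inl ⟨hlt, hm⟩⟩
      · exact Or.inr ⟨h', Or.inr ⟨hlt, hm⟩⟩
  · rintro u v ⟨-, ⟨h1, h2⟩ | ⟨h1, h2⟩⟩ ⟨-, ⟨h3, h4⟩ | ⟨h3, h4⟩⟩
    · exact lt_asymm h1 h3
    · exact h4 h2
    · exact h2 h4
    · exact lt_asymm h1 h3
  · intro A hA D hD
    obtain ⟨a, hainj, haA, hpat⟩ := hc A hA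
    have hstep : ∀ (l : ℕ) (x : OmegaOne), ∃ b ∈ A, x < b ∧ ∀ k ≤ l,
        a k < b ∧ G.Adj b (a k) ∧ (a k ∈ c b ↔ D.Adj (l, 1) (k, 0)) := by
      intro l x
      obtain ⟨b, hbA, hxb, hb⟩ := hpat ((Finset.range (l + 1)).image a)
        (((Finset.range (l + 1)).filter fun k => D.Adj (l, 1) (k, 0)).image a)
        (by simp) (by rw [Finset.coe_image]; exact Set.image_subset_range _ _)
        (Finset.image_subset_image (Finset.filter_subset _ _)) x
      refine ⟨b, hbA, hxb, fun k hk => ?_⟩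
      obtain ⟨h1, h2, h3⟩ := hb (a k)
        (Finset.mem_image_of_mem _ (Finset.mem_range.2 (Nat.lt_succ_of_le hk)))
      refine ⟨h1, h2, h3.trans ?_⟩
      rw [hainj.mem_finset_image, Finset.mem_filter, Finset.mem_range]
      exact and_iff_right (Nat.lt_succ_of_le hk)
    choose B hBA hlt hB using hstep
    obtain ⟨x₀, hx₀⟩ := OmegaOne.exists_forall_lt (Set.countable_range a)
    let s : ℕ → OmegaOne := fun n => Nat.rec x₀ (fun n x => B n x) n
    have hs : StrictMono s := strictMono_nat_of_lt_succ fun n => hlt n (s n)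
    have hab : ∀ k l, a k < s l := fun k l =>
      (hx₀ _ ⟨k, rfl⟩).trans_le (hs.monotone (Nat.zero_le l))
    let F : ℕ × Fin 2 → A := fun p =>
      if p.2 = 0 then ⟨a p.1, haA _⟩ else ⟨s (p.1 + 1), hBA _ _⟩
    have hF0 : ∀ k, (F (k, 0) : OmegaOne) = a k := fun k => rfl
    have hF1 : ∀ l, (F (l, 1) : OmegaOne) = s (l + 1) := fun l => rfl
    refine ⟨F, ?_, ?_⟩
    · rintro ⟨k, i⟩ ⟨l, j⟩ hkl
      have hkl' := congrArg Subtype.val hkl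
      fin_cases i <;> fin_cases j <;> simp only [Fin.zero_eta, Fin.mk_one] at hkl' ⊢
      · rw [hF0, hF0] at hkl'; rw [hainj hkl']
      · rw [hF0, hF1] at hkl'; exact absurd hkl' (hab k (l + 1)).ne
      · rw [hF0, hF1] at hkl'; exact absurd hkl' (hab l (k + 1)).ne'
      · rw [hF1, hF1] at hkl'; rw [Nat.succ_injective (hs.injective hkl')]
    · rintro ⟨k, i⟩ ⟨l, j⟩ hkl
      have hE : halfGraph.Adj (k, i) (l, j) := (hD.adj_iff _ _).2 (Or.inl hkl)
      rcases hE with ⟨h0, h1, hle⟩ | ⟨h0, h1, hle⟩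
      · obtain rfl : i = 0 := h0
        obtain rfl : j = 1 := h1
        obtain ⟨h1, h2, h3⟩ := hB l (s l) k hle
        exact ⟨h2.symm, Or.inr ⟨h1, fun h => hD.asymm _ _ hkl (h3.1 h)⟩⟩
      · obtain rfl : j = 0 := h0
        obtain rfl : i = 1 := h1
        obtain ⟨h1, h2, h3⟩ := hB k (s k) l hle
        exact ⟨h2, Or.inl ⟨h1, h3.2 hkl⟩⟩

theorem SimpleGraph.cardChromaticNumber_le_aleph0 {V : Type*} {G : SimpleGraph V} (f : V → ℕ)
    (hf : ∀ x y, G.Adj x y → f x ≠ f y) : G.cardChromaticNumber ≤ ℵ₀ := by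
  have hmem : #(Set.range fun n : ℕ => f ⁻¹' {n}) ∈
      {κ | ∃ 𝒜 : Set (Set V), (∀ A ∈ 𝒜, G.IsIndepSet A) ∧ ⋃₀ 𝒜 = Set.univ ∧ #𝒜 = κ} := by
    refine ⟨_, ?_, ?_, rfl⟩
    · rintro _ ⟨n, rfl⟩ x hx y hy - hadj
      exact hf x y hadj (hx.trans hy.symm)
    · exact Set.eq_univ_of_forall fun x => ⟨_, ⟨f x, rfl⟩, rfl⟩
  exact (csInf_le' hmem).trans (Cardinal.le_aleph0_iff_set_countable.2 (Set.countable_range _))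

theorem SimpleGraph.exists_nat_coloring {V : Type*} {G : SimpleGraph V}
    (h : G.cardChromaticNumber ≤ ℵ₀) : ∃ f : V → ℕ, ∀ x y, G.Adj x y → f x ≠ f y := by
  have hne : {κ | ∃ 𝒜 : Set (Set V), (∀ A ∈ 𝒜, G.IsIndepSet A) ∧ ⋃₀ 𝒜 = Set.univ ∧
      #𝒜 = κ}.Nonempty :=
    ⟨_, Set.range fun x : V => {x}, by rintro _ ⟨x, rfl⟩; exact Set.pairwise_singleton _ _,
      Set.eq_univ_of_forall fun x => ⟨_, ⟨x, rfl⟩, rfl⟩, rfl⟩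
  obtain ⟨𝒜, hind, hcov, hcard⟩ := csInf_mem hne
  have hcount : 𝒜.Countable := by
    rw [← Cardinal.le_aleph0_iff_set_countable, hcard]; exact h
  obtain ⟨e, he⟩ := Set.countable_iff_exists_injOn.1 hcount
  have hx : ∀ x, ∃ A ∈ 𝒜, x ∈ A := fun x => by
    have : x ∈ ⋃₀ 𝒜 := hcov ▸ Set.mem_univ x
    exact this
  choose g hg hxg using hx
  refine ⟨fun x => e (g x), fun x y hadj heq => ?_⟩
  have hgg : g x = g y := he (hg x) (hg y) heq
  exact hind _ (hg y) (hgg ▸ hxg x) (hxg y) hadj.ne hadj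

theorem SimpleGraph.cardChromaticNumber_le_mk {V : Type*} (G : SimpleGraph V) :
    G.cardChromaticNumber ≤ #V := by
  refine (csInf_le' ?_).trans (Cardinal.mk_range_le (f := fun x : V => ({x} : Set V)))
  refine ⟨_, ?_, ?_, rfl⟩
  · rintro _ ⟨x, rfl⟩
    exact Set.pairwise_singleton _ _
  · exact Set.eq_univ_of_forall fun x => ⟨_, ⟨x, rfl⟩, rfl⟩

theorem Digraph.IsOrientationOf.isAcyclicSet {V : Type*} {D : Digraph V} {G : SimpleGraph V}
    (hD : D.IsOrientationOf G) {A : Set V} (hA : G.IsIndepSet A) : D.IsAcyclicSet A := by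
  rintro n - ⟨f, -, hf⟩
  have hadj : G.Adj (f 0) (f (0 + 1)) := (hD.adj_iff _ _).2 (Or.inl (hf 0 (0 + 1) rfl))
  exact hA (f 0).2 (f (0 + 1)).2 hadj.ne hadj

theorem Digraph.IsOrientationOf.dichromaticNumber_le {V : Type*} {D : Digraph V}
    {G : SimpleGraph V} (hD : D.IsOrientationOf G) :
    D.dichromaticNumber ≤ G.cardChromaticNumber := by
  refine le_csInf ⟨_, Set.range fun x : V => {x}, ?_, ?_, rfl⟩ ?_
  · rintro _ ⟨x, rfl⟩
    exact Set.pairwise_singleton _ _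
  · exact Set.eq_univ_of_forall fun x => ⟨_, ⟨x, rfl⟩, rfl⟩
  · rintro _ ⟨𝒜, hind, hcov, rfl⟩
    exact csInf_le' ⟨𝒜, fun A hA => hD.isAcyclicSet (hind A hA), hcov, rfl⟩

theorem exists_orientation_halfGraph_directedCycle :
    ∃ D : Digraph (ℕ × Fin 2), D.IsOrientationOf halfGraph ∧
      (Digraph.directedCycle 4).EmbedsInto D := by
  refine ⟨⟨fun p q => (p.2 = 0 ∧ q.2 = 1 ∧ q.1 = p.1 + 1) ∨
    (q.2 = 0 ∧ p.2 = 1 ∧ q.1 ≤ p.1 ∧ p.1 ≠ q.1 + 1)⟩, ⟨?_, ?_⟩, ?_⟩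
  · rintro ⟨k, i⟩ ⟨l, j⟩
    simp only [halfGraph]
    omega
  · rintro ⟨k, i⟩ ⟨l, j⟩
    simp only
    omega
  · refine ⟨(![(0, 0), (1, 1), (1, 0), (2, 1)] : Fin 4 → ℕ × Fin 2), ?_, ?_⟩
    · show Function.Injective (![(0, 0), (1, 1), (1, 0), (2, 1)] : Fin 4 → ℕ × Fin 2)
      decide
    · intro u v (h : v = u + 1)
      subst h
      revert u
      show ∀ u : Fin 4, _
      intro u
      fin_cases u <;> simp <;> decide

/-- The orientation result for graphs of size `ℵ₁`. -/
theorem DiamondPlus.exists_orientation (hdiamond : DiamondPlus) {V : Type*} (G : SimpleGraph V)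
    (hV : #V = ℵ₁) :
    ∃ Dstar : Digraph V, Dstar.IsOrientationOf G ∧
      ∀ A : Set V, ℵ₀ < (G.induce A).cardChromaticNumber →
        ∀ D : Digraph (ℕ × Fin 2), D.IsOrientationOf halfGraph →
          D.EmbedsInto (Dstar.inducedOn A) := by
  obtain ⟨φ⟩ : Nonempty (V ≃ OmegaOne) := by
    rw [← Cardinal.lift_mk_eq', hV, OmegaOne.mk_eq]
    simp
  obtain ⟨D', hD', h⟩ := hdiamond.exists_orientation_omegaOne (G.comap φ.symm)
  refine ⟨⟨fun x y => D'.Adj (φ x) (φ y)⟩, ⟨fun u v => ?_, fun u v => hD'.asymm _ _⟩, ?_⟩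
  · rw [← hD'.adj_iff]
    simp
  · intro A hA D hD
    refine (h (φ '' A) ?_ D hD).trans ?_
    · rintro ⟨f, hf⟩
      refine hA.not_ge (SimpleGraph.cardChromaticNumber_le_aleph0 (fun x => f (φ x)) ?_)
      intro x y hxy
      exact hf _ ⟨x, x.2, rfl⟩ _ ⟨y, y.2, rfl⟩ (by simpa using hxy)
    · refine ⟨fun x => ⟨φ.symm x, ?_⟩, fun x y hxy => ?_, fun x y hxy => ?_⟩
      · obtain ⟨_, a, ha, rfl⟩ := x
        simpa using ha
      · exact Subtype.ext (φ.symm.injective (congrArg Subtype.val hxy))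
      · show D'.Adj (φ (φ.symm x)) (φ (φ.symm y))
        rw [φ.apply_symm_apply, φ.apply_symm_apply]
        exact hxy

theorem Digraph.aleph0_lt_dichromaticNumber {V : Type*} {G : SimpleGraph V} {D : Digraph V}
    (hG : ℵ₀ < G.cardChromaticNumber)
    (hA : ∀ A : Set V, ℵ₀ < (G.induce A).cardChromaticNumber → ¬ D.IsAcyclicSet A)
    (hD : D.IsOrientationOf G) : ℵ₀ < D.dichromaticNumber := by
  by_contra! hle
  have hne : {κ | ∃ 𝒜 : Set (Set V), (∀ A ∈ 𝒜, D.IsAcyclicSet A) ∧ ⋃₀ 𝒜 = Set.univ ∧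
      #𝒜 = κ}.Nonempty :=
    ⟨_, Set.range fun x : V => {x}, by
      rintro _ ⟨x, rfl⟩; exact hD.isAcyclicSet (Set.pairwise_singleton _ _),
      Set.eq_univ_of_forall fun x => ⟨_, ⟨x, rfl⟩, rfl⟩, rfl⟩
  obtain ⟨𝒜, hacy, hcov, hcard⟩ := csInf_mem hne
  have hcount : 𝒜.Countable := by
    rw [← Cardinal.le_aleph0_iff_set_countable, hcard]; exact hle
  obtain ⟨e, he⟩ := Set.countable_iff_exists_injOn.1 hcount
  have hcol : ∀ A : 𝒜, ∃ f : ↥A.1 → ℕ, ∀ x y, (G.induce A.1).Adj x y → f x ≠ f y :=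
    fun A => SimpleGraph.exists_nat_coloring (not_lt.1 fun h => hA A h (hacy A A.2))
  choose f hf using hcol
  have hx : ∀ x, ∃ A : 𝒜, x ∈ A.1 := fun x => by
    have : x ∈ ⋃₀ 𝒜 := hcov ▸ Set.mem_univ x
    obtain ⟨A, h1, h2⟩ := this
    exact ⟨⟨A, h1⟩, h2⟩
  choose g hxg using hx
  refine hG.not_ge (SimpleGraph.cardChromaticNumber_le_aleph0
    (fun x => Nat.pair (e (g x)) (f (g x) ⟨x, hxg x⟩)) fun x y hadj heq => ?_)
  obtain ⟨h1, h2⟩ := Nat.pair_eq_pair.1 heq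
  have hgg : g x = g y := Subtype.ext (he (g x).2 (g y).2 h1)
  have hy : y ∈ (g x).1 := hgg ▸ hxg y
  have hcongr : ∀ B C : 𝒜, B = C → ∀ hB : y ∈ B.1, ∀ hC : y ∈ C.1, f B ⟨y, hB⟩ = f C ⟨y, hC⟩ := by
    rintro B _ rfl _ _
    rfl
  rw [hcongr (g y) (g x) hgg.symm (hxg y) hy] at h2
  exact hf (g x) ⟨x, hxg x⟩ ⟨y, hy⟩ hadj h2

theorem mainTheorem4 (hdiamond : DiamondPlus) {V : Type*} (G : SimpleGraph V) (hV : #V = ℵ₁) :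
    (G.cardChromaticNumber = ℵ₁ →
      ∃ Dstar : Digraph V, Dstar.IsOrientationOf G ∧
        ∀ A : Set V, ℵ₀ < (G.induce A).cardChromaticNumber →
          ∀ D : Digraph (ℕ × Fin 2), D.IsOrientationOf halfGraph →
            D.EmbedsInto (Dstar.inducedOn A)) ∧
    (G.cardChromaticNumber = ℵ₁ ↔ G.orientationDichromaticNumber = ℵ₁) := by
  obtain ⟨Dstar, hD, hemb⟩ := hdiamond.exists_orientation G hV
  have hle : G.cardChromaticNumber ≤ ℵ₁ := hV ▸ G.cardChromaticNumber_le_mk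
  have hub : ∀ D : {D : Digraph V // D.IsOrientationOf G},
      D.1.dichromaticNumber ≤ G.cardChromaticNumber := fun D => D.2.dichromaticNumber_le
  have hbdd : BddAbove (Set.range fun D : {D : Digraph V // D.IsOrientationOf G} =>
      D.1.dichromaticNumber) := ⟨_, by rintro _ ⟨D, rfl⟩; exact hub D⟩
  have hsup : G.orientationDichromaticNumber ≤ G.cardChromaticNumber := ciSup_le' hub
  refine ⟨fun _ => ⟨Dstar, hD, hemb⟩, fun hG => le_antisymm (hsup.trans hle) ?_,
    fun h => le_antisymm hle (h ▸ hsup)⟩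
  have hlt : ℵ₀ < Dstar.dichromaticNumber := by
    refine Digraph.aleph0_lt_dichromaticNumber (hG ▸ Cardinal.aleph0_lt_aleph_one) ?_ hD
    intro A hA hacy
    obtain ⟨D, hD, hcycle⟩ := exists_orientation_halfGraph_directedCycle
    exact hacy 4 (by norm_num) (hcycle.trans (hemb A hA D hD))
  have hge : ℵ₁ ≤ Dstar.dichromaticNumber := by
    rw [← Cardinal.succ_aleph0]; exact Order.succ_le_of_lt hlt
  exact hge.trans (le_ciSup hbdd ⟨Dstar, hD⟩)
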